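/- An augmented directed complex is a triple $(K,K^*,e)$, where $K$ is a chain complex of abelian groups in degrees $\geq 0$, $e\colon K_0\to\mathbb Z$ is an augmentation with $e d_1=0$, and $K^*_i$ is a submonoid of $K_i$ for every $i\geq 0$. A morphism is a chain map that commutes with the augmentations and sends $K^*_i$ into $K'^*_i$ for every $i$. Write $\mathcal C_{\mathrm{da}}$ for the category of augmented directed complexes and $\infty\text{-}\mathcal{C}at$ for the category of small strict $\infty$-categories and strict $\infty$-functors. The functor $\nu\colon\mathcal C_{\mathrm{da}}\to\infty\text{-}\mathcal{C}at$ is defined as follows. The $i$-cells of $\nu(K)$ are the tables $(x^\varepsilon_k)_{\varepsilon\in\{0,1\},\,0\le k\le i}$ with $x^\varepsilon_k\in K^*_k$, $d(x^\varepsilon_k)=x^1_{k-1}-x^0_{k-1}$ for $0<k\le i$, $e(x^\varepsilon_0)=1$ and $x^0_i=x^1_i$. For $j<i$, the $j$-source (resp. $j$-target) of $x$ keeps the entries of degree $<j$ and has both entries of degree $j$ equal to $x^0_j$ (resp. $x^1_j$). Identities add zero entries. If the $j$-source of $x$ is the $j$-target of $y$, then $x*_jy$ has the common entries of $x$ and $y$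 in degrees $<j$, the entries $y^0_j$, $x^1_j$ in degree $j$, and the entries $x^\varepsilon_k+y^\varepsilon_k$ in degrees $k>j$. Morphisms act entrywise. A basis of $K$ is a graded set $B=(B_i)_{i\ge 0}$ such that $B_i$ is a $\mathbb Z$-basis of $K_i$ and generates the monoid $K^*_i$, for every $i$. Given a basis, every $i$-chain $x$ is uniquely $x_+-x_-$ with $x_\pm$ positive of disjoint supports. The basis is unital if, for all $i$ and $b\in B_i$, one has $e(\langle b\rangle^0_0)=1=e(\langle b\rangle^1_0)$, where $\langle b\rangle^\varepsilon_i=b$, $\langle b\rangle^0_{k-1}=d(\langle b\rangle^0_k)_-$ and $\langle b\rangle^1_{k-1}=d(\langle b\rangle^1_k)_+$ for $0<k\le i$. It is strongly loop-free if the smallest preorder on $\coprod_i B_i$ such that $x\le y$ whenever $x\in\operatorname{supp}(d(y)_-)$ or $y\in\operatorname{supp}(d(x)_+)$ is a partial order (with $d(b)=0$ for $b\in B_0$). A strong Steiner complex is an augmented directed complex that has a unital and strongly loop-free basis. For $n\ge 0$, the $n$-truncation $\tau_n(K)$ of $K$ has $\tau_n(K)_i=K_i$ for $i<n$, $\tau_n(K)_n=K_n/d(K_{n+1})$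 and $\tau_n(K)_i=0$ for $i>n$; its positive chains are the images of those of $K$, and its differentials and augmentation are induced by those of $K$. Proposition. The restriction of $\nu\colon\mathcal C_{\mathrm{da}}\to\infty\text{-}\mathcal{C}at$ to the full subcategory of $\mathcal C_{\mathrm{da}}$ spanned by the strong Steiner complexes and their $n$-truncations, for all $n\ge 0$, is fully faithful. -/

import Mathlib

open CategoryTheory

universe u

/-! ### Strict `∞`-categories -/

/-- A small strict `∞`-category, presented by its sets of `i`-cells, the iterated sources and
targets `s_j, t_j`, the iterated identities, and the compositions `x ∗_j y` of two `i`-cells with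
`s_j x = t_j y`, for `j < i`. -/
structure StrictInfCat : Type (u + 1) where
  Cell : ℕ → Type u
  src : ∀ {i j : ℕ}, j ≤ i → Cell i → Cell j
  tgt : ∀ {i j : ℕ}, j ≤ i → Cell i → Cell j
  ident : ∀ {i j : ℕ}, i ≤ j → Cell i → Cell j
  comp : ∀ {i j : ℕ} (h : j < i) (x y : Cell i), src h.le x = tgt h.le y → Cell i
  src_self : ∀ {i : ℕ} (x : Cell i), src le_rfl x = x
  tgt_self : ∀ {i : ℕ} (x : Cell i), tgt le_rfl x = x
  src_src : ∀ {i j k : ℕ} (h : j ≤ i) (h' : k ≤ j) (x : Cell i),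
    src h' (src h x) = src (h'.trans h) x
  tgt_tgt : ∀ {i j k : ℕ} (h : j ≤ i) (h' : k ≤ j) (x : Cell i),
    tgt h' (tgt h x) = tgt (h'.trans h) x
  src_tgt : ∀ {i j k : ℕ} (h : j ≤ i) (h' : k < j) (x : Cell i),
    src h'.le (tgt h x) = src (h'.le.trans h) x
  tgt_src : ∀ {i j k : ℕ} (h : j ≤ i) (h' : k < j) (x : Cell i),
    tgt h'.le (src h x) = tgt (h'.le.trans h) x
  ident_self : ∀ {i : ℕ} (x : Cell i), ident le_rfl x = x
  ident_ident : ∀ {i j k : ℕ} (h : i ≤ j) (h' : j ≤ k) (x : Cell i),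
    ident h' (ident h x) = ident (h.trans h') x
  src_ident : ∀ {i j k : ℕ} (h : i ≤ k) (h' : k ≤ j) (x : Cell i),
    src h' (ident (h.trans h') x) = ident h x
  tgt_ident : ∀ {i j k : ℕ} (h : i ≤ k) (h' : k ≤ j) (x : Cell i),
    tgt h' (ident (h.trans h') x) = ident h x
  src_comp_self : ∀ {i j : ℕ} (h : j < i) (x y : Cell i) (w : src h.le x = tgt h.le y),
    src h.le (comp h x y w) = src h.le y
  tgt_comp_self : ∀ {i j : ℕ} (h : j < i) (x y : Cell i) (w : src h.le x = tgt h.le y),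
    tgt h.le (comp h x y w) = tgt h.le x
  src_comp : ∀ {i j k : ℕ} (h : j < k) (h' : k ≤ i) (x y : Cell i)
    (w : src (h.trans_le h').le x = tgt (h.trans_le h').le y)
    (w' : src h.le (src h' x) = tgt h.le (src h' y)),
    src h' (comp (h.trans_le h') x y w) = comp h (src h' x) (src h' y) w'
  tgt_comp : ∀ {i j k : ℕ} (h : j < k) (h' : k ≤ i) (x y : Cell i)
    (w : src (h.trans_le h').le x = tgt (h.trans_le h').le y)
    (w' : src h.le (tgt h' x) = tgt h.le (tgt h' y)),
    tgt h' (comp (h.trans_le h') x y w) = comp h (tgt h' x) (tgt h' y) w'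
  ident_comp : ∀ {i j k : ℕ} (h : j < i) (h' : i ≤ k) (x y : Cell i)
    (w : src h.le x = tgt h.le y)
    (w' : src (h.trans_le h').le (ident h' x) = tgt (h.trans_le h').le (ident h' y)),
    ident h' (comp h x y w) = comp (h.trans_le h') (ident h' x) (ident h' y) w'
  comp_ident : ∀ {i j : ℕ} (h : j < i) (x : Cell i)
    (w : src h.le x = tgt h.le (ident h.le (src h.le x))),
    comp h x (ident h.le (src h.le x)) w = x
  ident_comp_left : ∀ {i j : ℕ} (h : j < i) (x : Cell i)
    (w : src h.le (ident h.le (tgt h.le x)) = tgt h.le x),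
    comp h (ident h.le (tgt h.le x)) x w = x
  assoc : ∀ {i j : ℕ} (h : j < i) (x y z : Cell i)
    (w₁ : src h.le x = tgt h.le y) (w₂ : src h.le y = tgt h.le z)
    (w₃ : src h.le (comp h x y w₁) = tgt h.le z) (w₄ : src h.le x = tgt h.le (comp h y z w₂)),
    comp h (comp h x y w₁) z w₃ = comp h x (comp h y z w₂) w₄
  interchange : ∀ {i j k : ℕ} (h : k < j) (h' : j < i) (x y z t : Cell i)
    (w₁ : src h'.le x = tgt h'.le y) (w₂ : src h'.le z = tgt h'.le t)
    (w₃ : src (h.trans h').le x = tgt (h.trans h').le z)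
    (w₄ : src (h.trans h').le y = tgt (h.trans h').le t)
    (w₅ : src (h.trans h').le (comp h' x y w₁) = tgt (h.trans h').le (comp h' z t w₂))
    (w₆ : src h'.le (comp (h.trans h') x z w₃) = tgt h'.le (comp (h.trans h') y t w₄)),
    comp (h.trans h') (comp h' x y w₁) (comp h' z t w₂) w₅ =
      comp h' (comp (h.trans h') x z w₃) (comp (h.trans h') y t w₄) w₆

namespace StrictInfCat

/-- A (strict) `∞`-functor. -/
@[ext]
structure Hom (C D : StrictInfCat.{u}) : Type u where
  map : ∀ i : ℕ, C.Cell i → D.Cell i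
  map_src : ∀ {i j : ℕ} (h : j ≤ i) (x : C.Cell i), map j (C.src h x) = D.src h (map i x)
  map_tgt : ∀ {i j : ℕ} (h : j ≤ i) (x : C.Cell i), map j (C.tgt h x) = D.tgt h (map i x)
  map_ident : ∀ {i j : ℕ} (h : i ≤ j) (x : C.Cell i),
    map j (C.ident h x) = D.ident h (map i x)
  map_comp : ∀ {i j : ℕ} (h : j < i) (x y : C.Cell i) (w : C.src h.le x = C.tgt h.le y)
    (w' : D.src h.le (map i x) = D.tgt h.le (map i y)),
    map i (C.comp h x y w) = D.comp h (map i x) (map i y) w'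

/-- The category of small strict `∞`-categories and `∞`-functors. -/
instance : Category StrictInfCat.{u} where
  Hom := Hom
  id C :=
    { map := fun _ x => x
      map_src := fun _ _ => rfl
      map_tgt := fun _ _ => rfl
      map_ident := fun _ _ => rfl
      map_comp := fun _ _ _ _ _ => rfl }
  comp {C D E} F G :=
    { map := fun i x => G.map i (F.map i x)
      map_src := fun h x => by rw [F.map_src, G.map_src]
      map_tgt := fun h x => by rw [F.map_tgt, G.map_tgt]
      map_ident := fun h x => by rw [F.map_ident, G.map_ident]
      map_comp := fun h x y w w' => by
        have w'' : D.src h.le (F.map _ x) = D.tgt h.le (F.map _ y) := by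
          rw [← F.map_src, ← F.map_tgt, w]
        rw [F.map_comp h x y w w'', G.map_comp h _ _ w'' w'] }

end StrictInfCat

/-! ### Augmented directed complexes -/

/-- An augmented directed complex: a chain complex of abelian groups in non-negative degrees, with
an augmentation and a submonoid of positive chains in every degree. -/
structure ADC : Type (u + 1) where
  cx : ChainComplex AddCommGrpCat.{u} ℕ
  pos : ∀ i : ℕ, AddSubmonoid (cx.X i)
  aug : cx.X 0 →+ ℤ
  aug_d : ∀ x : cx.X 1, aug ((cx.d 1 0).hom x) = 0

namespace ADC

/-- The group of `i`-chains. -/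
abbrev Ch (K : ADC.{u}) (i : ℕ) : Type u := K.cx.X i

/-- The differential `K_{i+1} → K_i`. -/
def d (K : ADC.{u}) (i : ℕ) : K.Ch (i + 1) →+ K.Ch i := (K.cx.d (i + 1) i).hom

/-- Morphisms: chain maps that respect the augmentations and the positive chains. -/
@[ext]
structure Hom (K L : ADC.{u}) : Type u where
  cxMap : K.cx ⟶ L.cx
  map_pos : ∀ (i : ℕ), ∀ x ∈ K.pos i, (cxMap.f i).hom x ∈ L.pos i
  map_aug : ∀ x : K.Ch 0, L.aug ((cxMap.f 0).hom x) = K.aug x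

/-- The category of augmented directed complexes. -/
instance : Category ADC.{u} where
  Hom := Hom
  id K :=
    { cxMap := 𝟙 K.cx
      map_pos := fun _ _ hx => hx
      map_aug := fun _ => rfl }
  comp {K L M} f g :=
    { cxMap := f.cxMap ≫ g.cxMap
      map_pos := fun i x hx => g.map_pos i _ (f.map_pos i x hx)
      map_aug := fun x => (g.map_aug _).trans (f.map_aug x) }

/-- The component `K_i → L_i` of a morphism. -/
def Hom.app {K L : ADC.{u}} (f : Hom K L) (i : ℕ) : K.Ch i →+ L.Ch i := (f.cxMap.f i).hom

theorem Hom.app_d {K L : ADC.{u}} (f : Hom K L) (i : ℕ) (x : K.Ch (i + 1)) :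
    f.app i (K.d i x) = L.d i (f.app (i + 1) x) :=
  (ConcreteCategory.congr_hom (f.cxMap.comm (i + 1) i) x).symm

/-! ### The functor `ν` -/

/-- An `i`-cell of `ν(K)`: a table of chains `x^ε_k`, `k ≤ i`, where `ε = 0, 1` is encoded as
`false, true`. The table is extended by zero in the degrees `k > i`. -/
@[ext]
structure NuCell (K : ADC.{u}) (i : ℕ) : Type u where
  val : Bool → ∀ k : ℕ, K.Ch k
  mem_pos : ∀ ε k, k ≤ i → val ε k ∈ K.pos k
  d_val : ∀ ε k, k < i → K.d k (val ε (k + 1)) = val true k - val false k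
  aug_val : ∀ ε, K.aug (val ε 0) = 1
  top : val false i = val true i
  zero_above : ∀ ε k, i < k → val ε k = 0

namespace NuCell

variable {K : ADC.{u}} {i j k : ℕ}

/-- The iterated source (`η = 0`) or target (`η = 1`) in degree `j`: entries of degree `< j` are
kept, and both entries of degree `j` become `x^η_j`. -/
def bdry (η : Bool) (h : j ≤ i) (x : NuCell K i) : NuCell K j where
  val ε k := if k < j then x.val ε k else if k = j then x.val η k else 0
  mem_pos ε k hk := by
    split_ifs
    · exact x.mem_pos _ _ (by omega)
    · exact x.mem_pos _ _ (by omega)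
    · omega
  d_val ε k hk := by
    have := x.d_val
    rw [if_pos hk, if_pos hk]
    split_ifs
    · exact this _ _ (by omega)
    · exact this _ _ (by omega)
    · omega
  aug_val ε := by
    split_ifs
    · exact x.aug_val _
    · exact x.aug_val _
    · omega
  top := by simp
  zero_above ε k hk := by rw [if_neg (by omega), if_neg (by omega)]

/-- The iterated identity: columns of zeros are added. -/
def ident (h : i ≤ j) (x : NuCell K i) : NuCell K j where
  val := x.val
  mem_pos ε k _ := by
    rcases le_or_gt k i with hk | hk
    · exact x.mem_pos _ _ hk
    · rw [x.zero_above _ _ hk]; exact zero_mem _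
  d_val ε k _ := by
    rcases lt_trichotomy k i with hk | rfl | hk
    · exact x.d_val _ _ hk
    · rw [x.zero_above _ _ (Nat.lt_succ_self _), x.top, map_zero, sub_self]
    · rw [x.zero_above _ _ hk, x.zero_above _ _ hk, x.zero_above _ _ (by omega), map_zero,
        sub_self]
  aug_val := x.aug_val
  top := by
    rcases h.eq_or_lt with rfl | hk
    · exact x.top
    · rw [x.zero_above _ _ hk, x.zero_above _ _ hk]
  zero_above ε k hk := x.zero_above _ _ (by omega)

theorem val_of_lt {h h' : j ≤ i} {x y : NuCell K i} {η η' : Bool}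
    (w : bdry η h x = bdry η' h' y) (ε : Bool) (hk : k < j) : x.val ε k = y.val ε k := by
  have := congrArg (fun z => NuCell.val z ε k) w
  simpa [bdry, hk] using this

theorem val_of_eq {h h' : j ≤ i} {x y : NuCell K i} {η η' : Bool}
    (w : bdry η h x = bdry η' h' y) : x.val η j = y.val η' j := by
  have := congrArg (fun z => NuCell.val z true j) w
  simpa [bdry] using this

/-- The composition `x ∗_j y`: in degrees `k < j` it has the common entries of `x` and `y`, in
degree `j` the entries `y^0_j` and `x^1_j`, and in degrees `k > j` the entries
`x^ε_k + y^ε_k`. -/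
def comp (h : j < i) (x y : NuCell K i) (w : bdry false h.le x = bdry true h.le y) :
    NuCell K i where
  val ε k := if k < j then x.val ε k
    else if k = j then (if ε then x.val ε k else y.val ε k)
    else x.val ε k + y.val ε k
  mem_pos ε k hk := by
    split_ifs
    · exact x.mem_pos _ _ hk
    · exact x.mem_pos _ _ hk
    · exact y.mem_pos _ _ hk
    · exact add_mem (x.mem_pos _ _ hk) (y.mem_pos _ _ hk)
  d_val ε k hk := by
    rcases lt_trichotomy k j with hkj | rfl | hkj
    · rw [if_pos hkj, if_pos hkj]
      rcases Nat.lt_or_ge (k + 1) j with h1 | h1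
      · rw [if_pos h1]; exact x.d_val _ _ hk
      · rw [if_neg (by omega), if_pos (by omega)]
        split_ifs
        · exact x.d_val _ _ hk
        · rw [y.d_val _ _ hk, val_of_lt w _ hkj, val_of_lt w _ hkj]
    · have e := val_of_eq w
      simp only [lt_irrefl, if_false, if_true, Bool.false_eq_true]
      rw [if_neg (by omega), if_neg (by omega), map_add, x.d_val _ _ hk, y.d_val _ _ hk, e]
      abel
    · rw [if_neg (by omega), if_neg (by omega), if_neg (by omega), if_neg (by omega),
        if_neg (by omega), if_neg (by omega), map_add, x.d_val _ _ hk, y.d_val _ _ hk]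
      abel
  aug_val ε := by
    split_ifs
    · exact x.aug_val _
    · exact x.aug_val _
    · exact y.aug_val _
    · omega
  top := by
    rw [if_neg (by omega), if_neg (by omega), if_neg (by omega), if_neg (by omega), x.top, y.top]
  zero_above ε k hk := by
    rw [if_neg (by omega), if_neg (by omega), x.zero_above _ _ hk, y.zero_above _ _ hk, add_zero]

/-- The action of a morphism on cells, entry by entry. -/
def map {L : ADC.{u}} (f : Hom K L) (x : NuCell K i) : NuCell L i where
  val ε k := f.app k (x.val ε k)
  mem_pos ε k hk := f.map_pos k _ (x.mem_pos ε k hk)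
  d_val ε k hk := by rw [← f.app_d, x.d_val _ _ hk, map_sub]
  aug_val ε := (f.map_aug _).trans (x.aug_val ε)
  top := by rw [x.top]
  zero_above ε k hk := by rw [x.zero_above _ _ hk, map_zero]

theorem val_bdry (η : Bool) (h : j ≤ i) (x : NuCell K i) (ε : Bool) (k : ℕ) :
    (bdry η h x).val ε k = if k < j then x.val ε k else if k = j then x.val η k else 0 := rfl

theorem val_ident (h : i ≤ j) (x : NuCell K i) : (ident h x).val = x.val := rfl

theorem val_comp (h : j < i) (x y : NuCell K i) (w : bdry false h.le x = bdry true h.le y)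
    (ε : Bool) (k : ℕ) :
    (comp h x y w).val ε k = if k < j then x.val ε k
      else if k = j then (if ε then x.val ε k else y.val ε k)
      else x.val ε k + y.val ε k := rfl

theorem bdry_self (η : Bool) (x : NuCell K i) : bdry η le_rfl x = x := by
  ext ε k
  have h1 := x.top
  rw [val_bdry]
  split_ifs with h h'
  · rfl
  · subst h'
    cases ε <;> cases η <;> simp [h1]
  · exact (x.zero_above _ _ (by omega)).symm

theorem bdry_bdry_same (η : Bool) (h : j ≤ i) (h' : k ≤ j) (x : NuCell K i) :
    bdry η h' (bdry η h x) = bdry η (h'.trans h) x := by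
  ext ε l
  simp only [val_bdry]
  split_ifs <;> first | rfl | omega

theorem bdry_bdry (η θ : Bool) (h : j ≤ i) (h' : k < j) (x : NuCell K i) :
    bdry η h'.le (bdry θ h x) = bdry η (h'.le.trans h) x := by
  ext ε l
  simp only [val_bdry]
  split_ifs <;> first | rfl | omega

theorem bdry_ident (η : Bool) (h : i ≤ k) (h' : k ≤ j) (x : NuCell K i) :
    bdry η h' (ident (h.trans h') x) = ident h x := by
  ext ε l
  simp only [val_bdry, val_ident]
  split_ifs with h1 h2
  · rfl
  · subst h2
    rcases h.eq_or_lt with rfl | h3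
    · have := x.top
      cases ε <;> cases η <;> simp [this]
    · rw [x.zero_above _ _ h3, x.zero_above _ _ h3]
  · exact (x.zero_above _ _ (by omega)).symm

theorem bdry_comp (η : Bool) (h : j < k) (h' : k ≤ i) (x y : NuCell K i)
    (w : bdry false (h.trans_le h').le x = bdry true (h.trans_le h').le y)
    (w' : bdry false h.le (bdry η h' x) = bdry true h.le (bdry η h' y)) :
    bdry η h' (comp (h.trans_le h') x y w) = comp h (bdry η h' x) (bdry η h' y) w' := by
  ext ε l
  simp only [val_bdry, val_comp]
  split_ifs <;> first | rfl | omega | exact (add_zero _).symm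

theorem map_bdry {L : ADC.{u}} (f : Hom K L) (η : Bool) (h : j ≤ i) (x : NuCell K i) :
    map f (bdry η h x) = bdry η h (map f x) := by
  refine NuCell.ext ?_
  funext ε l
  change f.app l (ite _ _ _) = ite _ (f.app l _) _
  split_ifs <;> first | rfl | exact map_zero _

end NuCell

/-- The strict `∞`-category `ν(K)`. -/
def nuObj (K : ADC.{u}) : StrictInfCat.{u} where
  Cell := NuCell K
  src h x := NuCell.bdry false h x
  tgt h x := NuCell.bdry true h x
  ident h x := NuCell.ident h x
  comp h x y w := NuCell.comp h x y w
  src_self x := NuCell.bdry_self false x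
  tgt_self x := NuCell.bdry_self true x
  src_src h h' x := NuCell.bdry_bdry_same false h h' x
  tgt_tgt h h' x := NuCell.bdry_bdry_same true h h' x
  src_tgt h h' x := NuCell.bdry_bdry false true h h' x
  tgt_src h h' x := NuCell.bdry_bdry true false h h' x
  ident_self _ := rfl
  ident_ident _ _ _ := rfl
  src_ident h h' x := NuCell.bdry_ident false h h' x
  tgt_ident h h' x := NuCell.bdry_ident true h h' x
  src_comp_self h x y w := by
    ext ε k
    have h1 := NuCell.val_of_lt w (k := k)
    grind [NuCell.val_bdry, NuCell.val_comp]
  tgt_comp_self h x y w := by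
    ext ε k
    grind [NuCell.val_bdry, NuCell.val_comp]
  src_comp h h' x y w w' := NuCell.bdry_comp false h h' x y w w'
  tgt_comp h h' x y w w' := NuCell.bdry_comp true h h' x y w w'
  ident_comp _ _ _ _ _ _ := rfl
  comp_ident {i j} h x w := by
    ext ε k
    have h1 := x.top
    have h2 : j < k → x.val ε k + 0 = x.val ε k := fun _ => add_zero _
    simp only [NuCell.val_comp, NuCell.val_ident, NuCell.val_bdry]
    split_ifs <;> first | rfl | omega | simp_all
  ident_comp_left {i j} h x w := by
    ext ε k
    simp only [NuCell.val_comp, NuCell.val_ident, NuCell.val_bdry]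
    split_ifs <;> first | rfl | omega | simp_all
  assoc {i j} h x y z w₁ w₂ w₃ w₄ := by
    ext ε k
    simp only [NuCell.val_comp]
    split_ifs <;> first | rfl | omega | exact add_assoc _ _ _
  interchange {i j k} h h' x y z t w₁ w₂ w₃ w₄ w₅ w₆ := by
    ext ε l
    simp only [NuCell.val_comp]
    split_ifs <;> first | rfl | omega | exact add_add_add_comm _ _ _ _

/-- Steiner's functor `ν` from augmented directed complexes to strict `∞`-categories. -/
def nu : ADC.{u} ⥤ StrictInfCat.{u} where
  obj := nuObj
  map {K L} f :=
    { map := fun i x => NuCell.map f x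
      map_src := fun h x => NuCell.map_bdry f false h x
      map_tgt := fun h x => NuCell.map_bdry f true h x
      map_ident := fun _ _ => rfl
      map_comp := fun {i j} h x y w w' => by
        refine NuCell.ext ?_
        funext ε k
        change f.app k (ite _ _ _) = ite _ (f.app k _) _
        split_ifs <;> first | rfl | exact map_add _ _ _ }
  map_id _ := rfl
  map_comp _ _ := rfl

/-! ### Bases and strong Steiner complexes -/

/-- A basis of `K`: sets `B_i` of `i`-chains that are bases of the `ℤ`-modules `K_i` and generate
the monoids of positive chains. -/
structure Basis (K : ADC.{u}) : Type u where
  elts : ∀ i : ℕ, Set (K.Ch i)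
  basis : ∀ i : ℕ, Module.Basis (elts i) ℤ (K.Ch i)
  basis_apply : ∀ (i : ℕ) (b : elts i), basis i b = b
  closure_elts : ∀ i : ℕ, AddSubmonoid.closure (elts i) = K.pos i

namespace Basis

variable {K : ADC.{u}} (B : K.Basis)

/-- The support of a chain. -/
noncomputable def supp {i : ℕ} (x : K.Ch i) : Finset (B.elts i) := ((B.basis i).repr x).support

/-- The chains `x_-` (for `ε = 0`) and `x_+` (for `ε = 1`): the positive chains with disjoint
supports such that `x = x_+ - x_-`. -/
noncomputable def part (ε : Bool) {i : ℕ} (x : K.Ch i) : K.Ch i :=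
  (B.basis i).repr.symm
    (((B.basis i).repr x).mapRange (fun a : ℤ => max (if ε then a else -a) 0) (by simp))

/-- The entries `⟨x⟩^ε_k` of the table of an `i`-chain `x`, by recursion on `i`:
`⟨x⟩^ε_i = x` and, below, the entries are those of the table of `d(x)_-` resp. `d(x)_+`.
The entries of degree `k > i` are set to zero. -/
noncomputable def atom (ε : Bool) : ∀ i : ℕ, K.Ch i → ∀ k : ℕ, K.Ch k
  | 0, x => Pi.single 0 x
  | i + 1, x => Function.update (atom ε i (B.part ε (K.d i x))) (i + 1) x

/-- The basis is unital. -/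
def IsUnital : Prop :=
  ∀ (i : ℕ) (b : B.elts i) (ε : Bool), K.aug (B.atom ε i b 0) = 1

/-- The relation that generates the preorder `≤_ℕ` on the disjoint union of the `B_i`:
`x` is related to `y` if `x ∈ supp (d(y)_-)` or `y ∈ supp (d(x)_+)`. -/
inductive Rel : (Σ i, B.elts i) → (Σ i, B.elts i) → Prop
  | neg {i : ℕ} (x : B.elts i) (y : B.elts (i + 1)) :
      x ∈ B.supp (B.part false (K.d i y)) → Rel ⟨i, x⟩ ⟨i + 1, y⟩
  | pos {i : ℕ} (x : B.elts (i + 1)) (y : B.elts i) :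
      y ∈ B.supp (B.part true (K.d i x)) → Rel ⟨i + 1, x⟩ ⟨i, y⟩

/-- The basis is strongly loop-free: the preorder generated by `Rel` is a partial order. -/
def IsStronglyLoopFree : Prop :=
  ∀ x y, Relation.ReflTransGen B.Rel x y → Relation.ReflTransGen B.Rel y x → x = y

end Basis

/-- Strong Steiner complexes: the basis is unital and strongly loop-free. -/
def IsStrongSteiner (K : ADC.{u}) : Prop :=
  ∃ B : K.Basis, B.IsUnital ∧ B.IsStronglyLoopFree

/-! ### Truncations -/

/-- The subgroup of `K_i` by which the `n`-truncation divides: `0` for `i < n`, the boundaries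
`d(K_{n+1})` for `i = n`, and everything for `i > n`. -/
def truncSubgroup (n : ℕ) (K : ADC.{u}) (i : ℕ) : AddSubgroup (K.Ch i) :=
  if i < n then ⊥ else if i = n then (K.d i).range else ⊤

theorem truncSubgroup_le_comap (n : ℕ) (K : ADC.{u}) (i j : ℕ) :
    truncSubgroup n K i ≤ (truncSubgroup n K j).comap (K.cx.d i j).hom := by
  intro x hx
  rw [AddSubgroup.mem_comap]
  by_cases hij : j + 1 = i
  · subst hij
    unfold truncSubgroup at hx ⊢
    rcases lt_trichotomy j n with h | rfl | h
    · rw [if_pos h]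
      split_ifs at hx with h1 h2
      · rw [AddSubgroup.mem_bot] at hx ⊢
        rw [hx, map_zero]
      · obtain ⟨y, rfl⟩ := hx
        exact AddSubgroup.mem_bot.2
          (ConcreteCategory.congr_hom (K.cx.d_comp_d (j + 1 + 1) (j + 1) j) y)
      · omega
    · rw [if_neg (lt_irrefl _), if_pos rfl]
      exact ⟨x, rfl⟩
    · rw [if_neg (by omega), if_neg (by omega)]
      exact AddSubgroup.mem_top _
  · rw [K.cx.shape i j hij]
    exact zero_mem _

/-- The `n`-truncation of `K`: the complex `⋯ → 0 → K_n / d(K_{n+1}) → K_{n-1} → ⋯ → K_0`, written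
uniformly as a quotient in every degree, with the images of the positive chains as positive
chains. -/
def trunc (n : ℕ) (K : ADC.{u}) : ADC.{u} where
  cx :=
    { X := fun i => AddCommGrpCat.of (K.Ch i ⧸ truncSubgroup n K i)
      d := fun i j => AddCommGrpCat.ofHom
        (QuotientAddGroup.map _ _ (K.cx.d i j).hom (truncSubgroup_le_comap n K i j))
      shape := fun i j hij => by
        ext x
        exact congrArg (QuotientAddGroup.mk' (truncSubgroup n K j))
          (ConcreteCategory.congr_hom (K.cx.shape i j hij) x)
      d_comp_d' := fun i j k _ _ => by
        ext x
        exact congrArg (QuotientAddGroup.mk' (truncSubgroup n K k))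
          (ConcreteCategory.congr_hom (K.cx.d_comp_d i j k) x) }
  pos i := (K.pos i).map (QuotientAddGroup.mk' (truncSubgroup n K i))
  aug := QuotientAddGroup.lift _ K.aug (by
    intro x hx
    unfold truncSubgroup at hx
    split_ifs at hx with h1 h2
    · rw [AddSubgroup.mem_bot] at hx
      rw [hx]
      exact zero_mem _
    · obtain ⟨y, rfl⟩ := hx
      exact K.aug_d y
    · omega)
  aug_d x := by
    obtain ⟨x, rfl⟩ := QuotientAddGroup.mk_surjective x
    exact K.aug_d x

/-- The complexes that are (isomorphic to) strong Steiner complexes or their `n`-truncations. -/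
def steinerOrTrunc : ObjectProperty ADC.{u} := fun K =>
  K.IsStrongSteiner ∨
    ∃ (n : ℕ) (K' : ADC.{u}), K'.IsStrongSteiner ∧ Nonempty (K ≅ trunc n K')

end ADC

namespace ADC

/-! Only the source complex needs structure: for `K` strong Steiner or a truncation of one, `ν` is
bijective on morphisms from `K` to an arbitrary augmented directed complex `L`.

Let `K` be strong Steiner with basis `B`. Each basis element `b` gives a cell `⟨b⟩` with top entry
`b`, so `ν(f)` determines `f` on the basis. Conversely, an `∞`-functor `F` prescribes a value on
`b`, namely the top entry of `F⟨b⟩`, and this extends linearly. Top entries vanish on proper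
identities and add under composition, so the extension computes the top entry of `F(x)` for every
cell `x` generated by atoms and identities. Lower entries are top entries of iterated sources and
targets, so the extension recovers all of `F`.

What carries the proof is therefore the generation theorem `NuCell.induction_atoms`. A cell is cut
along `∗_j` at a single basis element of degree `j + 1`. Such a cut needs the source (or target) of
the cell to absorb the boundary of that element, which `add_d_mem_pos` and `sub_d_mem_pos` guarantee
for minimal (or maximal) elements of the support. Strong loop-freeness supplies these elements.

For a truncation, a functor is precomposed with the projection from `K`. The resulting morphism out
of `K` vanishes above degree `n`, hence kills `d(K_{n+1})` and descends. -/

theorem d_d (K : ADC.{u}) (i : ℕ) (x : K.Ch (i + 2)) : K.d i (K.d (i + 1) x) = 0 :=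
  ConcreteCategory.congr_hom (K.cx.d_comp_d (i + 1 + 1) (i + 1) i) x

/-! ### Chains over a basis: coefficients, positivity, supports. -/

namespace Basis

variable {K : ADC.{u}} (B : K.Basis) {i : ℕ}

/-- The coefficient of the basis element `b` in a chain. -/
noncomputable def coeff (b : B.elts i) : K.Ch i →+ ℤ :=
  ((B.basis i).coord b).toAddMonoidHom

theorem coeff_apply (b : B.elts i) (x : K.Ch i) : B.coeff b x = (B.basis i).repr x b := rfl

theorem mem_supp {b : B.elts i} {x : K.Ch i} : b ∈ B.supp x ↔ B.coeff b x ≠ 0 := by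
  simp [supp, coeff_apply]

theorem ext_coeff {x y : K.Ch i} (h : ∀ b, B.coeff b x = B.coeff b y) : x = y :=
  (B.basis i).repr.injective (Finsupp.ext h)

theorem coeff_elt [DecidableEq (B.elts i)] (b c : B.elts i) :
    B.coeff b (c : K.Ch i) = if c = b then 1 else 0 := by
  rw [coeff_apply, ← B.basis_apply i c, Module.Basis.repr_self, Finsupp.single_apply]

theorem coeff_elt_of_ne {b c : B.elts i} (h : c ≠ b) : B.coeff b (c : K.Ch i) = 0 := by
  classical simp [coeff_elt, h]

theorem coeff_part (ε : Bool) (b : B.elts i) (x : K.Ch i) :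
    B.coeff b (B.part ε x) = max (if ε then B.coeff b x else -B.coeff b x) 0 := by
  simp [coeff_apply, part]

theorem elt_mem_pos (b : B.elts i) : (b : K.Ch i) ∈ K.pos i :=
  B.closure_elts i ▸ AddSubmonoid.subset_closure b.2

/-- A chain is the linear combination of the basis elements with its coefficients. -/
theorem sum_coeff (x : K.Ch i) : ∑ b ∈ B.supp x, B.coeff b x • (b : K.Ch i) = x := by
  conv_rhs => rw [← (B.basis i).linearCombination_repr x]
  rw [Finsupp.linearCombination_apply, Finsupp.sum]
  exact Finset.sum_congr rfl fun b _ => by rw [B.basis_apply, coeff_apply]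

/-- The positive monoid is generated by the basis, so it is the orthant of nonnegative coefficients.
Positivity questions thereby become integer inequalities, one basis element at a time. -/
theorem mem_pos_iff {x : K.Ch i} : x ∈ K.pos i ↔ ∀ b, 0 ≤ B.coeff b x := by
  constructor
  · intro hx b
    rw [← B.closure_elts i] at hx
    induction hx using AddSubmonoid.closure_induction with
    | mem y hy =>
      classical
      rw [B.coeff_elt b ⟨y, hy⟩]
      split_ifs <;> simp
    | zero => simp
    | add y z _ _ hy hz => rw [map_add]; exact add_nonneg hy hz
  · intro h
    rw [← B.sum_coeff x]
    refine sum_mem fun b _ => ?_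
    lift B.coeff b x to ℕ using h b with n
    rw [natCast_zsmul]
    exact nsmul_mem (B.elt_mem_pos b) n

theorem part_mem_pos (ε : Bool) (x : K.Ch i) : B.part ε x ∈ K.pos i :=
  B.mem_pos_iff.2 fun b => by rw [coeff_part]; exact le_max_right _ _

theorem part_sub_part (x : K.Ch i) : B.part true x - B.part false x = x :=
  B.ext_coeff fun b => by
    rw [map_sub, coeff_part, coeff_part]
    simp only [if_true, Bool.false_eq_true, if_false]
    omega

theorem mem_supp_part_true {b : B.elts i} {x : K.Ch i} :
    b ∈ B.supp (B.part true x) ↔ 0 < B.coeff b x := by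
  rw [mem_supp, coeff_part, if_pos rfl]
  omega

theorem mem_supp_part_false {b : B.elts i} {x : K.Ch i} :
    b ∈ B.supp (B.part false x) ↔ B.coeff b x < 0 := by
  rw [mem_supp, coeff_part, if_neg Bool.false_ne_true]
  omega

theorem mem_supp_of_sub_mem_pos {x y : K.Ch i} (hx : x ∈ K.pos i) (hxy : y - x ∈ K.pos i)
    {b : B.elts i} (hb : b ∈ B.supp x) : b ∈ B.supp y := by
  rw [mem_supp] at hb ⊢
  have h1 := B.mem_pos_iff.1 hx b
  have h2 := B.mem_pos_iff.1 hxy b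
  rw [map_sub] at h2
  omega

theorem sub_elt_mem_pos {x : K.Ch i} (hx : x ∈ K.pos i) {b : B.elts i} (hb : b ∈ B.supp x) :
    x - b ∈ K.pos i := by
  classical
  refine B.mem_pos_iff.2 fun c => ?_
  have h1 := B.mem_pos_iff.1 hx c
  rw [map_sub, B.coeff_elt]
  rw [mem_supp] at hb
  split_ifs with h
  · subst h; omega
  · omega

/-- An additive functional that is positive on a positive chain is positive on some basis element
of its support. -/
theorem exists_mem_supp_pos (φ : K.Ch i →+ ℤ) {x : K.Ch i} (hx : x ∈ K.pos i) (h : 0 < φ x) :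
    ∃ b ∈ B.supp x, 0 < φ b := by
  rw [← B.sum_coeff x, map_sum] at h
  obtain ⟨b, hb, h⟩ := Finset.exists_lt_of_sum_lt (s := B.supp x) (f := fun _ => (0 : ℤ))
    (by simpa using h)
  refine ⟨b, hb, ?_⟩
  exact pos_of_mul_pos_right h (B.mem_pos_iff.1 hx b)

theorem supp_nonempty {x : K.Ch i} (h : x ≠ 0) : (B.supp x).Nonempty := by
  rw [supp, Finsupp.support_nonempty_iff]
  simpa using h

/-- The sum of the coefficients of a chain. -/
noncomputable def deg (i : ℕ) : K.Ch i →+ ℤ :=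
  (Finsupp.degree (R := ℤ)).comp (B.basis i).repr.toLinearMap.toAddMonoidHom

theorem deg_elt (b : B.elts i) : B.deg i b = 1 := by
  rw [← B.basis_apply i b]
  simp [deg]

theorem deg_nonneg {x : K.Ch i} (hx : x ∈ K.pos i) : 0 ≤ B.deg i x := by
  rw [← B.sum_coeff x, map_sum]
  refine Finset.sum_nonneg fun b _ => ?_
  rw [map_zsmul, deg_elt, smul_eq_mul, mul_one]
  exact B.mem_pos_iff.1 hx b

/-- Induction on positive chains by removal of a basis element. -/
theorem pos_induction {p : ∀ x : K.Ch i, x ∈ K.pos i → Prop}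
    (step : ∀ x hx, (∀ b ∈ B.supp x, ∀ h, p (x - (b : K.Ch i)) h) → p x hx) : ∀ x hx, p x hx := by
  -- The sum of the coefficients is the measure: it is nonnegative on positive chains and drops by
  -- one at each removal.
  have key : ∀ (n : ℕ) (x : K.Ch i) (hx : x ∈ K.pos i), B.deg i x = n → p x hx := by
    intro n
    induction n with
    | zero =>
      intro x hx h0
      refine step x hx fun b _ h => ?_
      have := B.deg_nonneg h
      rw [map_sub, deg_elt, h0] at this
      simp at this
    | succ n ih =>
      intro x hx h1
      refine step x hx fun b _ h => ih _ h ?_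
      rw [map_sub, deg_elt, h1]
      simp
  intro x hx
  exact key (B.deg i x).toNat x hx (Int.toNat_of_nonneg (B.deg_nonneg hx)).symm

/-! ### The order on the basis elements -/

/-- The preorder generated by `Rel`. -/
def Le (x y : Σ i, B.elts i) : Prop := Relation.ReflTransGen B.Rel x y

theorem le_of_coeff_neg {a : B.elts i} {b : B.elts (i + 1)} (h : B.coeff a (K.d i b) < 0) :
    B.Le ⟨i, a⟩ ⟨i + 1, b⟩ :=
  .single (.neg a b (B.mem_supp_part_false.2 h))

theorem le_of_coeff_pos {a : B.elts i} {b : B.elts (i + 1)} (h : 0 < B.coeff a (K.d i b)) :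
    B.Le ⟨i + 1, b⟩ ⟨i, a⟩ :=
  .single (.pos b a (B.mem_supp_part_true.2 h))

variable {B}

theorem IsStronglyLoopFree.exists_minimal (hB : B.IsStronglyLoopFree) {s : Finset (B.elts i)}
    (hs : s.Nonempty) : ∃ b ∈ s, ∀ c ∈ s, B.Le ⟨i, c⟩ ⟨i, b⟩ → c = b := by
  let : PartialOrder (Σ i, B.elts i) :=
    { le := B.Le
      le_refl := fun _ => .refl
      le_trans := fun _ _ _ => .trans
      le_antisymm := hB }
  obtain ⟨b, hb, h⟩ := s.exists_minimalFor (fun b => (⟨i, b⟩ : Σ i, B.elts i)) hs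
  exact ⟨b, hb, fun c hc hcb => by simpa using hB _ _ hcb (h hc hcb)⟩

theorem IsStronglyLoopFree.exists_maximal (hB : B.IsStronglyLoopFree) {s : Finset (B.elts i)}
    (hs : s.Nonempty) : ∃ b ∈ s, ∀ c ∈ s, B.Le ⟨i, b⟩ ⟨i, c⟩ → c = b := by
  let : PartialOrder (Σ i, B.elts i) :=
    { le := B.Le
      le_refl := fun _ => .refl
      le_trans := fun _ _ _ => .trans
      le_antisymm := hB }
  obtain ⟨b, hb, h⟩ := s.exists_maximalFor (fun b => (⟨i, b⟩ : Σ i, B.elts i)) hs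
  exact ⟨b, hb, fun c hc hcb => by simpa using hB _ _ (h hc hcb) hcb⟩

variable (B)

/-- If a positive chain `v` bounds from `y` to `z` and `c` is a minimal element of the support of
`v`, then `y` contains the source of `c`. -/
theorem add_d_mem_pos {v : K.Ch (i + 1)}
    {y z : K.Ch i} (hv : v ∈ K.pos (i + 1)) (hy : y ∈ K.pos i) (hz : z ∈ K.pos i)
    (hd : K.d i v = z - y) {c : B.elts (i + 1)} (hc : c ∈ B.supp v)
    (hmin : ∀ c' ∈ B.supp v, B.Le ⟨i + 1, c'⟩ ⟨i + 1, c⟩ → c' = c) :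
    y + K.d i c ∈ K.pos i := by
  refine B.mem_pos_iff.2 fun a => ?_
  have hya := B.mem_pos_iff.1 hy a
  have hza := B.mem_pos_iff.1 hz a
  rw [map_add]
  by_contra! hneg
  have hca : B.coeff a (K.d i c) < 0 := by omega
  have hv' := B.sub_elt_mem_pos hv hc
  -- The source `y` cannot supply all the copies of `a` that `c` consumes, so the rest of `v` must
  -- produce some. A producer `c'` satisfies `c' ≤ a ≤ c`, against minimality.
  have hpos : 0 < ((B.coeff a).comp (K.d i)) (v - c) := by
    rw [AddMonoidHom.comp_apply, map_sub, hd, map_sub, map_sub]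
    omega
  obtain ⟨c', hc', h⟩ := B.exists_mem_supp_pos _ hv' hpos
  have hc'v : c' ∈ B.supp v :=
    B.mem_supp_of_sub_mem_pos hv' (by rw [sub_sub_cancel]; exact B.elt_mem_pos c) hc'
  obtain rfl := hmin c' hc'v ((B.le_of_coeff_pos h).trans (B.le_of_coeff_neg hca))
  rw [AddMonoidHom.comp_apply] at h
  omega

/-- If a positive chain `v` bounds from `y` to `z` and `c` is a maximal element of the support of
`v`, then `z` contains the target of `c`. -/
theorem sub_d_mem_pos {v : K.Ch (i + 1)}
    {y z : K.Ch i} (hv : v ∈ K.pos (i + 1)) (hy : y ∈ K.pos i) (hz : z ∈ K.pos i)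
    (hd : K.d i v = z - y) {c : B.elts (i + 1)} (hc : c ∈ B.supp v)
    (hmax : ∀ c' ∈ B.supp v, B.Le ⟨i + 1, c⟩ ⟨i + 1, c'⟩ → c' = c) :
    z - K.d i c ∈ K.pos i := by
  refine B.mem_pos_iff.2 fun a => ?_
  have hya := B.mem_pos_iff.1 hy a
  have hza := B.mem_pos_iff.1 hz a
  rw [map_sub]
  by_contra! hneg
  have hca : 0 < B.coeff a (K.d i c) := by omega
  have hv' := B.sub_elt_mem_pos hv hc
  have hpos : 0 < (-(B.coeff a).comp (K.d i)) (v - c) := by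
    rw [AddMonoidHom.neg_apply, AddMonoidHom.comp_apply, map_sub, hd, map_sub, map_sub]
    omega
  obtain ⟨c', hc', h⟩ := B.exists_mem_supp_pos _ hv' hpos
  have hc'v : c' ∈ B.supp v :=
    B.mem_supp_of_sub_mem_pos hv' (by rw [sub_sub_cancel]; exact B.elt_mem_pos c) hc'
  rw [AddMonoidHom.neg_apply, AddMonoidHom.comp_apply] at h
  obtain rfl := hmax c' hc'v
    ((B.le_of_coeff_pos hca).trans (B.le_of_coeff_neg (by omega)))
  omega

/-! ### Atoms -/

theorem atom_self (ε : Bool) : ∀ (i : ℕ) (x : K.Ch i), B.atom ε i x i = x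
  | 0, x => Pi.single_eq_same 0 x
  | _ + 1, _ => Function.update_self ..

theorem atom_of_le (ε : Bool) {k : ℕ} (h : k ≤ i) (x : K.Ch (i + 1)) :
    B.atom ε (i + 1) x k = B.atom ε i (B.part ε (K.d i x)) k :=
  Function.update_of_ne (by omega) ..

theorem atom_of_lt (ε : Bool) {k : ℕ} : ∀ (i : ℕ) (x : K.Ch i), i < k → B.atom ε i x k = 0
  | 0, x, h => Pi.single_eq_of_ne (by omega) x
  | i + 1, x, h => (Function.update_of_ne (by omega) ..).trans (atom_of_lt ε i _ (by omega))

theorem atom_mem_pos (ε : Bool) : ∀ (i : ℕ) (x : K.Ch i), x ∈ K.pos i →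
    ∀ k, B.atom ε i x k ∈ K.pos k := by
  intro i
  induction i with
  | zero =>
    intro x hx k
    rcases Nat.eq_zero_or_pos k with rfl | hk
    · rwa [atom_self]
    · rw [atom_of_lt _ _ _ _ hk]; exact zero_mem _
  | succ i ih =>
    intro x hx k
    rcases lt_trichotomy k (i + 1) with hk | rfl | hk
    · rw [atom_of_le _ _ (by omega)]; exact ih _ (B.part_mem_pos _ _) k
    · rwa [atom_self]
    · rw [atom_of_lt _ _ _ _ hk]; exact zero_mem _

theorem atom_eq_part (ε : Bool) {k : ℕ} : ∀ (i : ℕ) (x : K.Ch i), k < i →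
    B.atom ε i x k = B.part ε (K.d k (B.atom ε i x (k + 1))) := by
  intro i
  induction i with
  | zero => intro x h; omega
  | succ i ih =>
    intro x h
    rcases Nat.lt_succ_iff_lt_or_eq.1 h with hk | rfl
    · rw [atom_of_le _ _ (by omega), atom_of_le _ _ (by omega), ih _ hk]
    · rw [atom_of_le _ _ le_rfl, atom_self, atom_self]

/-- The two rows of the table of one chain start from the same entry but continue from its negative
and positive boundary parts. The invariant that survives the recursion is that the two starting
chains differ by a boundary; `d_atom` is the case of equal chains. -/
theorem d_atom_aux {k : ℕ} : ∀ (i : ℕ) (x y : K.Ch i) (z : K.Ch (i + 1)), K.d i z = y - x →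
    k < i → K.d k (B.atom false i x (k + 1)) = B.atom true i y k - B.atom false i x k ∧
      K.d k (B.atom true i y (k + 1)) = B.atom true i y k - B.atom false i x k := by
  intro i
  induction i with
  | zero => intro x y z hz h; omega
  | succ i ih =>
    intro x y z hz h
    have hxy : K.d i y = K.d i x := by
      rw [← sub_eq_zero, ← map_sub, ← hz, d_d]
    -- The next pair of chains again differs by a boundary, that of `y`.
    have hy : K.d i y = B.part true (K.d i y) - B.part false (K.d i x) := by
      rw [← hxy, part_sub_part]
    rw [atom_of_le _ _ (Nat.lt_succ_iff.1 h), atom_of_le _ _ (Nat.lt_succ_iff.1 h)]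
    rcases Nat.lt_succ_iff_lt_or_eq.1 h with hk | rfl
    · rw [atom_of_le _ _ (by omega), atom_of_le _ _ (by omega)]
      exact ih _ _ y hy hk
    · rw [atom_self, atom_self, atom_self, atom_self]
      exact ⟨hxy ▸ hy, hy⟩

theorem d_atom (ε : Bool) {k : ℕ} (x : K.Ch i) (h : k < i) :
    K.d k (B.atom ε i x (k + 1)) = B.atom true i x k - B.atom false i x k := by
  have := B.d_atom_aux i x x 0 (by simp) h
  cases ε
  exacts [this.1, this.2]

/-- Each descent in the lower row passes to a negative boundary part, and an element of `d(x)_-`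
lies in `d(b)_-` for some `b` in the support of `x`. Composing these relations puts the lower row of
`⟨b⟩` below `b`; dually, the upper row lies above `b`. -/
theorem le_of_mem_supp_atom_false {k : ℕ} (a : B.elts k) : ∀ (i : ℕ) (x : K.Ch i), x ∈ K.pos i →
    a ∈ B.supp (B.atom false i x k) → ∃ b ∈ B.supp x, B.Le ⟨k, a⟩ ⟨i, b⟩ := by
  intro i
  induction i with
  | zero =>
    intro x hx ha
    rcases Nat.eq_zero_or_pos k with rfl | hk
    · rw [atom_self] at ha; exact ⟨a, ha, .refl⟩
    · rw [atom_of_lt _ _ _ _ hk, mem_supp, map_zero] at ha; exact absurd rfl ha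
  | succ i ih =>
    intro x hx ha
    rcases lt_trichotomy k (i + 1) with hk | rfl | hk
    · rw [atom_of_le _ _ (by omega)] at ha
      obtain ⟨c, hc, hac⟩ := ih _ (B.part_mem_pos _ _) ha
      rw [mem_supp_part_false] at hc
      obtain ⟨b, hb, h⟩ := B.exists_mem_supp_pos (-(B.coeff c).comp (K.d i)) hx
        (by rw [AddMonoidHom.neg_apply, AddMonoidHom.comp_apply]; omega)
      rw [AddMonoidHom.neg_apply, AddMonoidHom.comp_apply] at h
      exact ⟨b, hb, hac.trans (B.le_of_coeff_neg (by omega))⟩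
    · rw [atom_self] at ha; exact ⟨a, ha, .refl⟩
    · rw [atom_of_lt _ _ _ _ hk, mem_supp, map_zero] at ha; exact absurd rfl ha

theorem le_of_mem_supp_atom_true {k : ℕ} (a : B.elts k) : ∀ (i : ℕ) (x : K.Ch i), x ∈ K.pos i →
    a ∈ B.supp (B.atom true i x k) → ∃ b ∈ B.supp x, B.Le ⟨i, b⟩ ⟨k, a⟩ := by
  intro i
  induction i with
  | zero =>
    intro x hx ha
    rcases Nat.eq_zero_or_pos k with rfl | hk
    · rw [atom_self] at ha; exact ⟨a, ha, .refl⟩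
    · rw [atom_of_lt _ _ _ _ hk, mem_supp, map_zero] at ha; exact absurd rfl ha
  | succ i ih =>
    intro x hx ha
    rcases lt_trichotomy k (i + 1) with hk | rfl | hk
    · rw [atom_of_le _ _ (by omega)] at ha
      obtain ⟨c, hc, hac⟩ := ih _ (B.part_mem_pos _ _) ha
      rw [mem_supp_part_true] at hc
      obtain ⟨b, hb, h⟩ := B.exists_mem_supp_pos ((B.coeff c).comp (K.d i)) hx hc
      exact ⟨b, hb, (B.le_of_coeff_pos h).trans hac⟩
    · rw [atom_self] at ha; exact ⟨a, ha, .refl⟩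
    · rw [atom_of_lt _ _ _ _ hk, mem_supp, map_zero] at ha; exact absurd rfl ha

theorem eq_of_mem_supp_elt {b c : B.elts i} (h : c ∈ B.supp (b : K.Ch i)) : c = b := by
  rw [mem_supp] at h
  by_contra hne
  exact h (B.coeff_elt_of_ne (Ne.symm hne))

end Basis

end ADC

/-! ### Cutting a cell along a chain. -/

namespace ADC

variable {K : ADC.{u}}

theorem d_single_d (j k : ℕ) (c : K.Ch (j + 1)) :
    K.d k ((Pi.single j (K.d j c) : ∀ k, K.Ch k) (k + 1)) = 0 := by
  rcases eq_or_ne (k + 1) j with rfl | h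
  · rw [Pi.single_eq_same, d_d]
  · rw [Pi.single_eq_of_ne h, map_zero]

theorem d_single_succ (j k : ℕ) (c : K.Ch (j + 1)) :
    K.d k ((Pi.single (j + 1) c : ∀ k, K.Ch k) (k + 1)) =
      (Pi.single j (K.d j c) : ∀ k, K.Ch k) k := by
  rcases eq_or_ne k j with rfl | h
  · rw [Pi.single_eq_same, Pi.single_eq_same]
  · rw [Pi.single_eq_of_ne h, Pi.single_eq_of_ne (by omega), map_zero]

namespace NuCell

variable {i j : ℕ}

/-- The cell obtained by adding a chain `c` to both entries of degree `j + 1`, and correcting the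
target (`η = 1`) or the source (`η = 0`) in degree `j` by the boundary of `c`. -/
def addChain (η : Bool) (h : j < i) (x : NuCell K i) (c : K.Ch (j + 1))
    (hj : x.val η j + (if η then K.d j c else -K.d j c) ∈ K.pos j)
    (hc : ∀ ε, x.val ε (j + 1) + c ∈ K.pos (j + 1)) : NuCell K i where
  val ε k := x.val ε k + (if ε = η then
    (Pi.single j (if η then K.d j c else -K.d j c) : ∀ k, K.Ch k) k else 0) +
    (Pi.single (j + 1) c : ∀ k, K.Ch k) k
  mem_pos ε k hk := by
    rcases eq_or_ne k j with rfl | h1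
    · rw [Pi.single_eq_same, Pi.single_eq_of_ne (by omega), add_zero]
      split_ifs with h2 h3
      · subst h2 h3; simpa using hj
      · subst h2; simpa [h3] using hj
      · rw [add_zero]; exact x.mem_pos _ _ hk
    · rw [Pi.single_eq_of_ne h1, ite_self, add_zero]
      rcases eq_or_ne k (j + 1) with rfl | h2
      · rw [Pi.single_eq_same]; exact hc ε
      · rw [Pi.single_eq_of_ne h2, add_zero]; exact x.mem_pos _ _ hk
  d_val ε k hk := by
    have h1 := d_single_d j k c
    have h2 := d_single_succ j k c
    have h3 := x.d_val ε k hk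
    cases ε <;> cases η <;> simp [h1, h2, h3, Pi.single_neg] <;> abel
  aug_val ε := by
    rw [Pi.single_eq_of_ne (by omega : 0 ≠ j + 1), add_zero, map_add, x.aug_val, add_eq_left]
    split_ifs
    · rcases Nat.eq_zero_or_pos j with rfl | hj
      · rw [Pi.single_eq_same]; exact K.aug_d c
      · rw [Pi.single_eq_of_ne hj.ne, map_zero]
    · rcases Nat.eq_zero_or_pos j with rfl | hj
      · rw [Pi.single_eq_same, map_neg, neg_eq_zero]; exact K.aug_d c
      · rw [Pi.single_eq_of_ne hj.ne, map_zero]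
    · exact map_zero _
  top := by simp [Pi.single_eq_of_ne h.ne', x.top]
  zero_above ε k hk := by
    rw [x.zero_above _ _ hk, Pi.single_eq_of_ne (by omega), Pi.single_eq_of_ne (by omega)]
    simp

theorem val_addChain (η : Bool) (h : j < i) (x : NuCell K i) (c : K.Ch (j + 1))
    (hj : x.val η j + (if η then K.d j c else -K.d j c) ∈ K.pos j)
    (hc : ∀ ε, x.val ε (j + 1) + c ∈ K.pos (j + 1)) (ε : Bool) (k : ℕ) :
    (addChain η h x c hj hc).val ε k = x.val ε k + (if ε = η then
      (Pi.single j (if η then K.d j c else -K.d j c) : ∀ k, K.Ch k) k else 0) +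
      (Pi.single (j + 1) c : ∀ k, K.Ch k) k := rfl

/-- If the source of `x` in degree `j` contains the source of a `(j + 1)`-chain `c` contained in
`x`, then `x` decomposes along `∗_j` with a right factor whose entry of degree `j + 1` is `c`. -/
theorem exists_comp_right (h : j < i) (x : NuCell K i) {c : K.Ch (j + 1)}
    (hc : c ∈ K.pos (j + 1)) (hx : ∀ ε, x.val ε (j + 1) - c ∈ K.pos (j + 1))
    (hj : x.val false j + K.d j c ∈ K.pos j) :
    ∃ (y : NuCell K i) (z : NuCell K (j + 1)) (w : _),
      x = comp h y (ident h z) w ∧ z.val true (j + 1) = c ∧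
        ∀ ε k, j < k → y.val ε k = x.val ε k - (Pi.single (j + 1) c : ∀ k, K.Ch k) k := by
  refine ⟨addChain false h x (-c) (by simpa using hj) (by simpa [sub_eq_add_neg] using hx),
    addChain true (Nat.lt_succ_self j) (ident (Nat.le_succ j) (bdry false h.le x)) c
      (by simpa [val_ident, val_bdry] using hj) (by simpa [val_ident, val_bdry] using hc),
    ?_, ?_, ?_, ?_⟩
  · ext ε k
    simp only [val_bdry, val_ident, val_addChain]
    rcases lt_trichotomy k j with hk | rfl | hk
    · simp [hk, Pi.single_eq_of_ne hk.ne, Pi.single_eq_of_ne (by omega : k ≠ j + 1)]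
    · simp
    · simp [hk.not_gt, hk.ne']
  · ext ε k
    simp only [val_comp, val_bdry, val_ident, val_addChain]
    rcases lt_trichotomy k j with hk | rfl | hk
    · simp [hk, Pi.single_eq_of_ne hk.ne, Pi.single_eq_of_ne (by omega : k ≠ j + 1)]
    · cases ε <;> simp
    · simp [hk.not_gt, hk.ne', Pi.single_neg]
  · simp [val_ident, val_bdry, val_addChain]
  · intro ε k hk
    simp [val_addChain, Pi.single_eq_of_ne hk.ne', Pi.single_neg, sub_eq_add_neg]

/-- If the target of `x` in degree `j` contains the target of a `(j + 1)`-chain `c` contained in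
`x`, then `x` decomposes along `∗_j` with a left factor whose entry of degree `j + 1` is `c`. -/
theorem exists_comp_left (h : j < i) (x : NuCell K i) {c : K.Ch (j + 1)}
    (hc : c ∈ K.pos (j + 1)) (hx : ∀ ε, x.val ε (j + 1) - c ∈ K.pos (j + 1))
    (hj : x.val true j - K.d j c ∈ K.pos j) :
    ∃ (y : NuCell K i) (z : NuCell K (j + 1)) (w : _),
      x = comp h (ident h z) y w ∧ z.val true (j + 1) = c ∧
        ∀ ε k, j < k → y.val ε k = x.val ε k - (Pi.single (j + 1) c : ∀ k, K.Ch k) k := by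
  refine ⟨addChain true h x (-c) (by simpa [sub_eq_add_neg] using hj)
      (by simpa [sub_eq_add_neg] using hx),
    addChain false (Nat.lt_succ_self j) (ident (Nat.le_succ j) (bdry true h.le x)) c
      (by simpa [val_ident, val_bdry, sub_eq_add_neg] using hj)
      (by simpa [val_ident, val_bdry] using hc),
    ?_, ?_, ?_, ?_⟩
  · ext ε k
    simp only [val_bdry, val_ident, val_addChain]
    rcases lt_trichotomy k j with hk | rfl | hk
    · simp [hk, Pi.single_eq_of_ne hk.ne, Pi.single_eq_of_ne (by omega : k ≠ j + 1)]
    · simp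
    · simp [hk.not_gt, hk.ne']
  · ext ε k
    simp only [val_comp, val_bdry, val_ident, val_addChain]
    rcases lt_trichotomy k j with hk | rfl | hk
    · simp [hk, Pi.single_eq_of_ne hk.ne, Pi.single_eq_of_ne (by omega : k ≠ j + 1)]
    · cases ε <;> simp
    · simp [hk.not_gt, hk.ne', Pi.single_neg]
  · simp [val_ident, val_bdry, val_addChain]
  · intro ε k hk
    simp [val_addChain, Pi.single_eq_of_ne hk.ne', Pi.single_neg, sub_eq_add_neg]

end NuCell

/-! ### Atoms as cells, and augmentation of positive `0`-chains. -/

namespace Basis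

variable {B : K.Basis} {i : ℕ}

/-- The cell `⟨b⟩` of a basis element `b`. -/
noncomputable def IsUnital.atomCell (hB : B.IsUnital) (b : B.elts i) : NuCell K i where
  val ε := B.atom ε i b
  mem_pos ε k _ := B.atom_mem_pos ε i b (B.elt_mem_pos b) k
  d_val ε _ hk := B.d_atom ε (b : K.Ch i) hk
  aug_val ε := hB i b ε
  top := by rw [atom_self, atom_self]
  zero_above ε _ hk := B.atom_of_lt ε i b hk

theorem IsUnital.atomCell_val (hB : B.IsUnital) (b : B.elts i) (ε : Bool) :
    (hB.atomCell b).val ε = B.atom ε i b := rfl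

theorem IsUnital.aug_elt (hB : B.IsUnital) (b : B.elts 0) : K.aug b = 1 := hB 0 b true

/-- A positive `0`-chain of augmentation zero vanishes. -/
theorem IsUnital.eq_zero_of_aug_eq_zero (hB : B.IsUnital) {x : K.Ch 0} (hx : x ∈ K.pos 0)
    (h : K.aug x = 0) : x = 0 := by
  -- Unitality gives every basis element of degree zero augmentation one, so the augmentation is the
  -- sum of the coefficients.
  have hdeg : B.deg 0 = K.aug := by
    refine AddMonoidHom.toIntLinearMap_injective ((B.basis 0).ext fun b => ?_)
    change B.deg 0 (B.basis 0 b) = K.aug (B.basis 0 b)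
    rw [B.basis_apply, deg_elt, hB.aug_elt]
  by_contra hne
  obtain ⟨b, hb⟩ := B.supp_nonempty hne
  have := B.deg_nonneg (B.sub_elt_mem_pos hx hb)
  rw [map_sub, deg_elt, hdeg, h] at this
  omega

end Basis

/-! ### Generation of cells by atoms and identities. -/

namespace NuCell

variable {i : ℕ}

/-- Every cell whose top entry vanishes is an identity. -/
theorem eq_ident_of_top_eq_zero (x : NuCell K (i + 1)) (h : x.val true (i + 1) = 0) :
    x = ident (Nat.le_succ i) (bdry true (Nat.le_succ i) x) := by
  have h0 := x.top
  have h1 := x.d_val true i (Nat.lt_succ_self i)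
  rw [h, map_zero, eq_comm, sub_eq_zero] at h1
  ext ε k
  rw [val_ident, val_bdry]
  split_ifs with h2 h3
  · rfl
  · subst h3; cases ε <;> simp [h1]
  · rcases eq_or_ne k (i + 1) with rfl | h4
    · cases ε <;> simp [h0, h]
    · exact x.zero_above _ _ (by omega)

/-- A cell that agrees with an atom `⟨b⟩` in degrees `≥ k` is generated by `⟨b⟩` and identities. -/
theorem induction_of_agree {B : K.Basis} (hB : B.IsUnital) (hB' : B.IsStronglyLoopFree)
    {P : NuCell K i → Prop} (b : B.elts i) (atom : P (hB.atomCell b))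
    (ident : ∀ (m : ℕ) (h : m < i) (z : NuCell K m), P (ident h.le z))
    (comp : ∀ (j : ℕ) (h : j < i) (x y : NuCell K i) (w : _), P x → P y → P (comp h x y w)) :
    ∀ k ≤ i, ∀ x : NuCell K i, (∀ ε l, k ≤ l → x.val ε l = B.atom ε i b l) → P x := by
  intro k
  induction k with
  | zero =>
    intro _ x hx
    obtain rfl : x = hB.atomCell b := NuCell.ext (funext₂ fun ε l => hx ε l (Nat.zero_le l))
    exact atom
  | succ k ih =>
    intro hk x hx
    -- In degree `k` the cell exceeds the atom by the same positive chain `u` in both rows. The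
    -- excess is removed one basis element at a time.
    have key : ∀ u ∈ K.pos k, ∀ x : NuCell K i, (∀ ε, x.val ε k = B.atom ε i b k + u) →
        (∀ ε l, k + 1 ≤ l → x.val ε l = B.atom ε i b l) → P x := by
      intro u hu
      induction u, hu using B.pos_induction with
      | step u hu ihu =>
        intro x hxk hxl
        by_cases hu0 : u = 0
        · refine ih (by omega) x fun ε l hl => ?_
          rcases hl.eq_or_lt with rfl | hl
          · rw [hxk, hu0, add_zero]
          · exact hxl ε l hl
        rcases k with _ | j
        · refine absurd (hB.eq_zero_of_aug_eq_zero hu ?_) hu0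
          have h1 := x.aug_val true
          rw [hxk, map_add, hB i b true] at h1
          omega
        have hatom ε : B.atom ε i b (j + 1) ∈ K.pos (j + 1) :=
          B.atom_mem_pos ε i b (B.elt_mem_pos b) _
        have hsub {c : B.elts (j + 1)} (hc : c ∈ B.supp u) (ε : Bool) :
            x.val ε (j + 1) - c = B.atom ε i b (j + 1) + (u - c) := by
          rw [hxk, add_sub_assoc]
        have hsub' {c : B.elts (j + 1)} (hc : c ∈ B.supp u) (ε : Bool) :
            x.val ε (j + 1) - c ∈ K.pos (j + 1) := by
          rw [hsub hc]
          exact add_mem (hatom ε) (B.sub_elt_mem_pos hu hc)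
        have hsupp ε {c : B.elts (j + 1)} (hc : c ∈ B.supp u) : c ∈ B.supp (x.val ε (j + 1)) :=
          B.mem_supp_of_sub_mem_pos hu (by rw [hxk, add_sub_cancel_right]; exact hatom ε) hc
        have hcases ε {c : B.elts (j + 1)} (hc : c ∈ B.supp (x.val ε (j + 1))) :
            c ∈ B.supp u ∨ c ∈ B.supp (B.atom ε i b (j + 1)) := by
          rw [B.mem_supp, B.mem_supp]
          rw [B.mem_supp, hxk, map_add] at hc
          omega
        have hy {c : B.elts (j + 1)} (hc : c ∈ B.supp u) (y : NuCell K i)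
            (h : ∀ ε k, j < k → y.val ε k =
              x.val ε k - (Pi.single (j + 1) (c : K.Ch (j + 1)) : ∀ k, K.Ch k) k) : P y := by
          refine ihu c hc (B.sub_elt_mem_pos hu hc) y (fun ε => ?_) (fun ε l hl => ?_)
          · rw [h ε _ (Nat.lt_succ_self j), Pi.single_eq_same, hsub hc]
          · rw [h ε _ (by omega), Pi.single_eq_of_ne (by omega), sub_zero, hxl _ _ hl]
        have hxpos ε (l : ℕ) (hl : l ≤ j + 1) := x.mem_pos ε l (hl.trans (by omega))
        -- If some element of `u` is not above `b`, a minimal such `c` is minimal in all of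
        -- `x^1_{j+1}`, since the atom's part there lies above `b`. It splits off on the right as an
        -- identity on a cell of dimension `j + 1 < i`.
        by_cases hex : ∃ c ∈ B.supp u, ¬ B.Le ⟨i, b⟩ ⟨j + 1, c⟩
        · classical
          obtain ⟨c₀, hc₀, hbc₀⟩ := hex
          obtain ⟨c, hc, hmin⟩ := hB'.exists_minimal
            (s := (B.supp u).filter fun c => ¬ B.Le ⟨i, b⟩ ⟨j + 1, c⟩)
            ⟨c₀, Finset.mem_filter.2 ⟨hc₀, hbc₀⟩⟩
          obtain ⟨hc, hbc⟩ := Finset.mem_filter.1 hc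
          obtain ⟨y, z, w, rfl, -, h⟩ := exists_comp_right (by omega : j < i) x
            (B.elt_mem_pos c) (hsub' hc)
            (B.add_d_mem_pos (hxpos true _ le_rfl) (hxpos false _ (by omega))
              (hxpos true _ (by omega)) (x.d_val true j (by omega)) (hsupp true hc)
              fun c' hc' hle => by
                rcases hcases true hc' with hc' | hc'
                · exact hmin c' (Finset.mem_filter.2 ⟨hc', fun h => hbc (h.trans hle)⟩) hle
                · obtain ⟨b', hb', h⟩ :=
                    B.le_of_mem_supp_atom_true c' i b (B.elt_mem_pos b) hc'
                  obtain rfl := B.eq_of_mem_supp_elt hb'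
                  exact absurd (h.trans hle) hbc)
          exact comp j _ _ _ w (hy hc y h) (ident _ (by omega) z)
        -- Now all of `u` lies above `b`, while the atom's part of `x^0_{j+1}` lies below `b`. A
        -- maximal `c` of `u` is then maximal in the whole entry: otherwise `c ≤ c' ≤ b ≤ c` would
        -- force `c = b`, impossible in different degrees. It splits off on the left.
        · push Not at hex
          obtain ⟨c, hc, hmax⟩ := hB'.exists_maximal (B.supp_nonempty hu0)
          obtain ⟨y, z, w, rfl, -, h⟩ := exists_comp_left (by omega : j < i) x
            (B.elt_mem_pos c) (hsub' hc)
            (B.sub_d_mem_pos (hxpos false _ le_rfl) (hxpos false _ (by omega))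
              (hxpos true _ (by omega)) (x.d_val false j (by omega)) (hsupp false hc)
              fun c' hc' hle => by
                rcases hcases false hc' with hc' | hc'
                · exact hmax c' hc' hle
                · obtain ⟨b', hb', h⟩ :=
                    B.le_of_mem_supp_atom_false c' i b (B.elt_mem_pos b) hc'
                  obtain rfl := B.eq_of_mem_supp_elt hb'
                  have := hB' _ _ (hle.trans h) (hex c hc)
                  have : i = j + 1 := (congrArg Sigma.fst this).symm
                  omega)
          exact comp j _ _ _ w (ident _ (by omega) z) (hy hc y h)
    -- The entries of the atom are the disjoint parts of the boundary, the least positive pair with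
    -- that difference, so the excess is positive.
    refine key (x.val false k - B.atom false i b k) ?_ x ?_ fun ε l => hx ε l
    · refine B.mem_pos_iff.2 fun a => ?_
      have h0 := B.mem_pos_iff.1 (x.mem_pos false k (by omega)) a
      have h1 := B.mem_pos_iff.1 (x.mem_pos true k (by omega)) a
      have h2 := congrArg (B.coeff a) (x.d_val false k hk)
      rw [hx _ _ le_rfl, map_sub] at h2
      rw [map_sub, B.atom_eq_part false i b hk, B.coeff_part, h2, if_neg Bool.false_ne_true]
      omega
    · have h1 := x.d_val false k hk
      rw [hx _ _ le_rfl, B.d_atom _ _ hk] at h1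
      intro ε
      cases ε
      · abel
      · rw [← add_sub_assoc, eq_sub_iff_add_eq, ← sub_eq_sub_iff_add_eq_add.1 h1]

/-- Steiner's generation theorem: all cells are generated by the atoms and the identities under
composition. -/
theorem induction_atoms {B : K.Basis} (hB : B.IsUnital) (hB' : B.IsStronglyLoopFree)
    {P : NuCell K i → Prop} (atom : ∀ b : B.elts i, P (hB.atomCell b))
    (ident : ∀ (m : ℕ) (h : m < i) (z : NuCell K m), P (ident h.le z))
    (comp : ∀ (j : ℕ) (h : j < i) (x y : NuCell K i) (w : _), P x → P y → P (comp h x y w))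
    (x : NuCell K i) : P x := by
  have htop (b : B.elts i) (x : NuCell K i) (hx : x.val true i = b) : P x := by
    refine induction_of_agree hB hB' b (atom b) ident comp i le_rfl x fun ε l hl => ?_
    rcases hl.eq_or_lt with rfl | hl
    · rw [B.atom_self]
      cases ε
      · rw [x.top, hx]
      · exact hx
    · rw [B.atom_of_lt _ _ _ hl, x.zero_above _ _ hl]
  rcases i with _ | j
  · have hpos := x.mem_pos true 0 le_rfl
    have haug := x.aug_val true
    obtain ⟨b, hb⟩ := B.supp_nonempty (x := x.val true 0) (by rintro h; simp [h] at haug)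
    refine htop b x (sub_eq_zero.1 (hB.eq_zero_of_aug_eq_zero (B.sub_elt_mem_pos hpos hb) ?_))
    rw [map_sub, haug, hB.aug_elt, sub_self]
  · have key : ∀ t ∈ K.pos (j + 1), ∀ x : NuCell K (j + 1), x.val true (j + 1) = t → P x := by
      intro t ht
      induction t, ht using B.pos_induction with
      | step t ht iht =>
        intro x hx
        by_cases h0 : t = 0
        · rw [x.eq_ident_of_top_eq_zero (hx.trans h0)]
          exact ident j (Nat.lt_succ_self j) _
        obtain ⟨b, hb, hmin⟩ := hB'.exists_minimal (B.supp_nonempty h0)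
        have hx' ε : x.val ε (j + 1) = t := by
          cases ε
          exacts [x.top.trans hx, hx]
        obtain ⟨y, z, w, rfl, hz, h⟩ := exists_comp_right (Nat.lt_succ_self j) x
          (B.elt_mem_pos b) (fun ε => by rw [hx']; exact B.sub_elt_mem_pos ht hb)
          (B.add_d_mem_pos ht (x.mem_pos false j (Nat.le_succ j))
            (x.mem_pos true j (Nat.le_succ j)) (by rw [← x.d_val true j (Nat.lt_succ_self j), hx])
            hb hmin)
        -- Here `j + 1` is the top dimension, so the factor split off is `z` itself, with top entry
        -- `b`.
        refine comp j _ _ _ w (iht b hb (B.sub_elt_mem_pos ht hb) y ?_) (htop b z hz)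
        rw [h _ _ (Nat.lt_succ_self j), hx', Pi.single_eq_same]
    exact key _ (x.mem_pos true _ le_rfl) x rfl

end NuCell

end ADC

/-! ### Morphisms and functors out of a strong Steiner complex. -/

namespace ADC

variable (n : ℕ) {K L : ADC.{u}}

/-- A morphism from its components. -/
def Hom.ofApp (f : ∀ i, K.Ch i →+ L.Ch i)
    (hd : ∀ i x, f i (K.d i x) = L.d i (f (i + 1) x))
    (hpos : ∀ i, ∀ x ∈ K.pos i, f i x ∈ L.pos i) (haug : ∀ x, L.aug (f 0 x) = K.aug x) :
    Hom K L where
  cxMap :=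
    { f := fun i => AddCommGrpCat.ofHom (f i)
      comm' := by
        rintro _ i rfl
        ext x
        exact (hd i x).symm }
  map_pos := hpos
  map_aug := haug

theorem Hom.ext_app {f g : Hom K L} (h : ∀ i x, f.app i x = g.app i x) : f = g := by
  refine Hom.ext ?_
  ext i x
  exact h i x

/-- The action of an `∞`-functor `ν(K) → ν(L)` on cells. -/
def cellMap (F : nuObj K ⟶ nuObj L) (i : ℕ) (x : NuCell K i) : NuCell L i := F.map i x

theorem cellMap_bdry (F : nuObj K ⟶ nuObj L) (η : Bool) {i j : ℕ} (h : j ≤ i) (x : NuCell K i) :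
    cellMap F j (NuCell.bdry η h x) = NuCell.bdry η h (cellMap F i x) := by
  cases η
  exacts [F.map_src h x, F.map_tgt h x]

theorem cellMap_ident (F : nuObj K ⟶ nuObj L) {i j : ℕ} (h : i ≤ j) (x : NuCell K i) :
    cellMap F j (NuCell.ident h x) = NuCell.ident h (cellMap F i x) :=
  F.map_ident h x

theorem cellMap_comp (F : nuObj K ⟶ nuObj L) {i j : ℕ} (h : j < i) (x y : NuCell K i)
    (w : NuCell.bdry false h.le x = NuCell.bdry true h.le y) :
    cellMap F i (NuCell.comp h x y w) = NuCell.comp h (cellMap F i x) (cellMap F i y)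
      (by rw [← cellMap_bdry, ← cellMap_bdry, w]) :=
  F.map_comp h x y w
    ((cellMap_bdry F false h.le x).symm.trans
      ((congrArg (cellMap F j) w).trans (cellMap_bdry F true h.le y)))

/-- An `∞`-functor is determined by its effect on the entries of top degree. -/
theorem val_cellMap (F : nuObj K ⟶ nuObj L) {i k : ℕ} (h : k ≤ i) (ε : Bool)
    (x : NuCell K i) :
    (cellMap F i x).val ε k = (cellMap F k (NuCell.bdry ε h x)).val true k := by
  rw [cellMap_bdry, NuCell.val_bdry, if_neg (lt_irrefl k), if_pos rfl]

theorem functor_ext {F G : nuObj K ⟶ nuObj L} (h : ∀ i x, cellMap F i x = cellMap G i x) :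
    F = G :=
  StrictInfCat.Hom.ext (funext₂ h)

theorem functor_ext_top {F G : nuObj K ⟶ nuObj L}
    (h : ∀ i x, (cellMap F i x).val true i = (cellMap G i x).val true i) : F = G := by
  refine functor_ext fun i x => ?_
  ext ε k
  rcases le_or_gt k i with hk | hk
  · rw [val_cellMap F hk, val_cellMap G hk, h]
  · rw [NuCell.zero_above _ _ _ hk, NuCell.zero_above _ _ _ hk]

/-- The functor `ν` is full on the morphisms with source `K`. -/
def IsNuFull (K : ADC.{u}) : Prop :=
  ∀ (L : ADC.{u}) (F : nuObj K ⟶ nuObj L), ∃ f : K ⟶ L, nu.map f = F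

/-- The functor `ν` is faithful on the morphisms with source `K`. -/
def IsNuFaithful (K : ADC.{u}) : Prop :=
  ∀ (L : ADC.{u}) (f g : K ⟶ L), nu.map f = nu.map g → f = g

namespace Basis

variable {B : K.Basis}

/-- The linear extension of the action of an `∞`-functor on the atoms. -/
noncomputable def IsUnital.extend (hB : B.IsUnital) (F : nuObj K ⟶ nuObj L) (i : ℕ) :
    K.Ch i →+ L.Ch i :=
  ((B.basis i).constr ℤ fun b =>
    (cellMap F i (hB.atomCell b)).val true i).toAddMonoidHom

theorem IsUnital.extend_elt (hB : B.IsUnital) (F : nuObj K ⟶ nuObj L) {i : ℕ} (b : B.elts i) :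
    hB.extend F i b = (cellMap F i (hB.atomCell b)).val true i := by
  conv_lhs => rw [← B.basis_apply i b]
  exact (B.basis i).constr_basis ℤ _ b

/-- Both sides agree on atoms by construction, vanish on proper identities and are additive under
composition; the generation theorem does the rest. -/
theorem IsUnital.val_cellMap (hB : B.IsUnital) (hB' : B.IsStronglyLoopFree) (F : nuObj K ⟶ nuObj L)
    {i : ℕ} (x : NuCell K i) :
    (cellMap F i x).val true i = hB.extend F i (x.val true i) := by
  induction x using NuCell.induction_atoms hB hB' with
  | atom b => rw [hB.atomCell_val, B.atom_self, hB.extend_elt]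
  | ident m h z =>
    rw [cellMap_ident, NuCell.val_ident, NuCell.val_ident, z.zero_above _ _ h,
      NuCell.zero_above _ _ _ h, map_zero]
  | comp j h x y w hx hy =>
    rw [cellMap_comp, NuCell.val_comp, NuCell.val_comp, if_neg h.not_gt, if_neg h.ne',
      if_neg h.not_gt, if_neg h.ne', hx, hy, map_add]

end Basis

theorem IsStrongSteiner.isNuFull (hK : K.IsStrongSteiner) : K.IsNuFull := by
  obtain ⟨B, hB, hB'⟩ := hK
  intro L F
  have hval := @Basis.IsUnital.val_cellMap K L B hB hB' F
  have hpos : ∀ i, ∀ x ∈ K.pos i, hB.extend F i x ∈ L.pos i := by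
    intro i x hx
    rw [← B.closure_elts i] at hx
    induction hx using AddSubmonoid.closure_induction with
    | mem y hy =>
      rw [hB.extend_elt F ⟨y, hy⟩]
      exact NuCell.mem_pos _ _ _ le_rfl
    | zero => rw [map_zero]; exact zero_mem _
    | add y z _ _ hy hz => rw [map_add]; exact add_mem hy hz
  have hval' {i k : ℕ} (hk : k ≤ i) (ε : Bool) (x : NuCell K i) :
      (cellMap F i x).val ε k = hB.extend F k (x.val ε k) := by
    rw [val_cellMap F hk, hval, NuCell.val_bdry, if_neg (lt_irrefl k), if_pos rfl]
  have hd : ∀ i x, hB.extend F i (K.d i x) = L.d i (hB.extend F (i + 1) x) := by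
    intro i
    refine DFunLike.congr_fun (f := (hB.extend F i).comp (K.d i))
      (g := (L.d i).comp (hB.extend F (i + 1))) ?_
    refine AddMonoidHom.toIntLinearMap_injective ((B.basis (i + 1)).ext fun b => ?_)
    rw [B.basis_apply]
    change hB.extend F i (K.d i b) = L.d i (hB.extend F (i + 1) b)
    -- Compatibility with `d` is read off from the tables of `⟨b⟩` and `F⟨b⟩`: in each, the boundary
    -- of the top entry is the difference of the two entries just below.
    have h1 := (hB.atomCell b).d_val true i (Nat.lt_succ_self i)
    rw [hB.atomCell_val b true, B.atom_self, ← hB.atomCell_val] at h1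
    rw [hB.extend_elt, NuCell.d_val _ _ _ (Nat.lt_succ_self i), h1, map_sub,
      hval' (Nat.le_succ i), hval' (Nat.le_succ i)]
  have haug : ∀ x, L.aug (hB.extend F 0 x) = K.aug x := by
    refine DFunLike.congr_fun (f := L.aug.comp (hB.extend F 0)) (g := K.aug) ?_
    refine AddMonoidHom.toIntLinearMap_injective ((B.basis 0).ext fun b => ?_)
    rw [B.basis_apply]
    change L.aug (hB.extend F 0 b) = K.aug b
    rw [hB.extend_elt, hB.aug_elt, NuCell.aug_val]
  refine ⟨Hom.ofApp (hB.extend F) hd hpos haug, functor_ext_top fun i x => ?_⟩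
  exact (hval x).symm

theorem IsStrongSteiner.isNuFaithful (hK : K.IsStrongSteiner) : K.IsNuFaithful := by
  obtain ⟨B, hB, -⟩ := hK
  intro L f g hfg
  refine Hom.ext_app fun i => ?_
  refine DFunLike.congr_fun (f := Hom.app f i) (g := Hom.app g i) ?_
  refine AddMonoidHom.toIntLinearMap_injective ((B.basis i).ext fun b => ?_)
  rw [B.basis_apply]
  have := congrArg (fun F => (cellMap F i (hB.atomCell b)).val true i) hfg
  change Hom.app f i (B.atom true i b i) = Hom.app g i (B.atom true i b i) at this
  rwa [B.atom_self] at this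

/-! ### Truncations -/

variable (K) in
/-- The projection of `K` to its truncation. -/
def truncProj : K ⟶ trunc n K :=
  Hom.ofApp (fun i => QuotientAddGroup.mk' (truncSubgroup n K i)) (fun _ _ => rfl)
    (fun _ x hx => ⟨x, hx, rfl⟩) (fun _ => rfl)

theorem truncProj_surjective (i : ℕ) : Function.Surjective (Hom.app (truncProj n K) i) :=
  QuotientAddGroup.mk'_surjective _

theorem truncProj_eq_zero_iff {i : ℕ} (x : K.Ch i) :
    Hom.app (truncProj n K) i x = 0 ↔ x ∈ truncSubgroup n K i :=
  QuotientAddGroup.eq_zero_iff x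

theorem truncProj_injective {i : ℕ} (hi : i < n) :
    Function.Injective (Hom.app (truncProj n K) i) := by
  refine (injective_iff_map_eq_zero _).2 fun x hx => ?_
  rw [truncProj_eq_zero_iff, truncSubgroup, if_pos hi] at hx
  exact hx

theorem trunc_eq_zero {i : ℕ} (hi : n < i) (x : (trunc n K).Ch i) : x = 0 := by
  obtain ⟨x, rfl⟩ := truncProj_surjective n i x
  rw [truncProj_eq_zero_iff, truncSubgroup, if_neg (by omega), if_neg (by omega)]
  exact AddSubgroup.mem_top x

theorem trunc_exists_pos {i : ℕ} {x : (trunc n K).Ch i} (hx : x ∈ (trunc n K).pos i) :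
    ∃ y ∈ K.pos i, Hom.app (truncProj n K) i y = x := hx

/-- The cells of the truncation of dimension at most `n` lift. -/
theorem exists_map_truncProj_eq {i : ℕ} (hi : i ≤ n) (x : NuCell (trunc n K) i) :
    ∃ y : NuCell K i, NuCell.map (truncProj n K) y = x := by
  have hlift : ∀ ε k, ∃ y : K.Ch k, (k ≤ i → y ∈ K.pos k) ∧
      Hom.app (truncProj n K) k y = x.val ε k ∧ (i < k → y = 0) := by
    intro ε k
    rcases le_or_gt k i with hk | hk
    · obtain ⟨y, hy, h⟩ := trunc_exists_pos n (x.mem_pos ε k hk)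
      exact ⟨y, fun _ => hy, h, fun h => by omega⟩
    · exact ⟨0, by omega, by rw [map_zero, x.zero_above _ _ hk], fun _ => rfl⟩
  choose v hv hvx hv0 using hlift
  -- the two entries of top degree are lifted to the same chain
  let v' : Bool → ∀ k, K.Ch k := fun ε k => if k = i then v true k else v ε k
  have hv'x : ∀ ε k, Hom.app (truncProj n K) k (v' ε k) = x.val ε k := by
    intro ε k
    by_cases hk : k = i
    · subst hk
      simp only [v', if_true, hvx]
      cases ε
      exacts [x.top.symm, rfl]
    · simp only [v', if_neg hk, hvx]
  refine ⟨⟨v', ?_, ?_, ?_, ?_, ?_⟩, NuCell.ext (funext₂ hv'x)⟩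
  · intro ε k hk
    simp only [v']
    split_ifs
    exacts [hv true k hk, hv ε k hk]
  · intro ε k hk
    -- The boundary equations live in degrees `k < n`, where the projection is injective, so they
    -- hold for any lift.
    refine truncProj_injective n (hk.trans_le hi) ?_
    rw [map_sub, Hom.app_d, hv'x, hv'x, hv'x, x.d_val ε k hk]
  · intro ε
    rw [← x.aug_val ε, ← hv'x]
    exact ((truncProj n K).map_aug _).symm
  · simp [v']
  · intro ε k hk
    simp only [v', if_neg hk.ne', hv0 ε k hk]

theorem trunc_cell_eq_ident {i : ℕ} (hi : n ≤ i) (x : NuCell (trunc n K) i) :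
    x = NuCell.ident hi (NuCell.bdry true hi x) := by
  induction i, hi using Nat.le_induction with
  | base => exact (NuCell.bdry_self true x).symm
  | succ i hi ih =>
    have h := x.eq_ident_of_top_eq_zero (trunc_eq_zero n (by omega) _)
    have h' := ih (NuCell.bdry true (Nat.le_succ i) x)
    rw [NuCell.bdry_bdry_same] at h'
    exact h.trans (congrArg (NuCell.ident (Nat.le_succ i)) h')

/-- A functor is determined by its composite with the projection to the truncation. -/
theorem trunc_functor_ext {F G : nuObj (trunc n K) ⟶ nuObj L}
    (h : nu.map (truncProj n K) ≫ F = nu.map (truncProj n K) ≫ G) : F = G := by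
  have key {i : ℕ} (hi : i ≤ n) (x : NuCell (trunc n K) i) : cellMap F i x = cellMap G i x := by
    obtain ⟨y, rfl⟩ := exists_map_truncProj_eq n hi x
    exact congrArg (fun H => cellMap H i y) h
  refine functor_ext fun i x => ?_
  rcases le_total i n with hi | hi
  · exact key hi x
  · rw [trunc_cell_eq_ident n hi x, cellMap_ident, cellMap_ident, key le_rfl]

/-- The functor is first realised on `K` by a morphism `g`. Above dimension `n` an atom projects to
an identity, so `g` vanishes there, and commuting with `d` makes it vanish on `d(K_{n+1})`. -/
theorem IsStrongSteiner.isNuFull_trunc (hK : K.IsStrongSteiner) : (trunc n K).IsNuFull := by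
  intro L F
  obtain ⟨g, hg⟩ := hK.isNuFull L (nu.map (truncProj n K) ≫ F)
  have hgt (i : ℕ) (hi : n < i) (x : K.Ch i) : Hom.app g i x = 0 := by
    obtain ⟨B, hB, hB'⟩ := hK
    suffices h : Hom.app g i = 0 by rw [h, AddMonoidHom.zero_apply]
    refine AddMonoidHom.toIntLinearMap_injective ((B.basis i).ext fun b => ?_)
    rw [B.basis_apply]
    change Hom.app g i b = 0
    have h1 := congrArg (fun F => (cellMap F i (hB.atomCell b)).val true i) hg
    change Hom.app g i (B.atom true i b i) =
      (cellMap F i (NuCell.map (truncProj n K) (hB.atomCell b))).val true i at h1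
    rwa [B.atom_self, trunc_cell_eq_ident n hi.le (NuCell.map _ _), cellMap_ident,
      NuCell.val_ident, NuCell.zero_above _ _ _ hi] at h1
  have hker (i : ℕ) : truncSubgroup n K i ≤ (Hom.app g i).ker := by
    intro x hx
    rw [AddMonoidHom.mem_ker]
    unfold truncSubgroup at hx
    split_ifs at hx with h1 h2
    · rw [AddSubgroup.mem_bot] at hx
      rw [hx, map_zero]
    · obtain ⟨y, rfl⟩ := hx
      rw [Hom.app_d, hgt _ (by omega), map_zero]
    · exact hgt i (by omega) x
  let f : trunc n K ⟶ L := Hom.ofApp (fun i => QuotientAddGroup.lift _ (Hom.app g i) (hker i))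
    (fun i x => by
      obtain ⟨x, rfl⟩ := truncProj_surjective n _ x
      exact Hom.app_d g i x)
    (fun i x hx => by
      obtain ⟨x, hx', rfl⟩ := trunc_exists_pos n hx
      exact g.map_pos i x hx')
    (fun x => by
      obtain ⟨x, rfl⟩ := truncProj_surjective n _ x
      exact g.map_aug x)
  have hf : truncProj n K ≫ f = g := Hom.ext_app fun _ _ => rfl
  exact ⟨f, trunc_functor_ext n
    ((nu.map_comp (truncProj n K) f).symm.trans ((congrArg nu.map hf).trans hg))⟩

theorem IsStrongSteiner.isNuFaithful_trunc (hK : K.IsStrongSteiner) :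
    (trunc n K).IsNuFaithful := by
  intro L f g hfg
  have h : truncProj n K ≫ f = truncProj n K ≫ g :=
    hK.isNuFaithful L _ _ (by rw [Functor.map_comp, Functor.map_comp, hfg])
  refine Hom.ext_app fun i x => ?_
  obtain ⟨x, rfl⟩ := truncProj_surjective n i x
  exact congrArg (fun k : K ⟶ L => Hom.app k i x) h

/-! ### Transport along isomorphisms and conclusion. -/

theorem IsNuFull.of_iso {K' : ADC.{u}} (h : K'.IsNuFull) (e : K ≅ K') : K.IsNuFull := by
  intro L F
  obtain ⟨f, hf⟩ := h L (nu.map e.inv ≫ F)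
  refine ⟨e.hom ≫ f, ?_⟩
  rw [Functor.map_comp, hf]
  exact (nu.mapIso e).hom_inv_id_assoc F

theorem IsNuFaithful.of_iso {K' : ADC.{u}} (h : K'.IsNuFaithful) (e : K ≅ K') :
    K.IsNuFaithful := by
  intro L f g hfg
  rw [← cancel_epi e.inv]
  exact h L _ _ (by rw [Functor.map_comp, Functor.map_comp, hfg])

theorem steinerOrTrunc.isNuFull (hK : steinerOrTrunc K) : K.IsNuFull := by
  rcases hK with hK | ⟨n, K', hK', ⟨e⟩⟩
  exacts [hK.isNuFull, (hK'.isNuFull_trunc n).of_iso e]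

theorem steinerOrTrunc.isNuFaithful (hK : steinerOrTrunc K) : K.IsNuFaithful := by
  rcases hK with hK | ⟨n, K', hK', ⟨e⟩⟩
  exacts [hK.isNuFaithful, (hK'.isNuFaithful_trunc n).of_iso e]

end ADC

theorem mainTheorem6 :
    (ADC.steinerOrTrunc.{u}.ι ⋙ ADC.nu.{u}).Full ∧
      (ADC.steinerOrTrunc.{u}.ι ⋙ ADC.nu.{u}).Faithful := by
  refine ⟨⟨fun {K L} F => ?_⟩, ⟨fun {K L} f g hfg => ?_⟩⟩
  · obtain ⟨f, hf⟩ := ADC.steinerOrTrunc.isNuFull K.property L.obj F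
    exact ⟨ObjectProperty.homMk f, hf⟩
  · exact ObjectProperty.hom_ext _ (ADC.steinerOrTrunc.isNuFaithful K.property L.obj _ _ hfg)
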